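/- For a real number $v$ and an integer $k\ge 0$ let $(v)_k=v(v+1)\cdots(v+k-1)$. Then both series below converge and $$\sum_{k=0}^{\infty}\frac{(\frac12)_k^2}{(1)_k^2}(\sqrt2-1)^{2k}\;\cdot\;\sum_{k=0}^{\infty}\frac{(\frac12)_k^2}{(1)_k^2}(\sqrt2-1)^{2k}\left[(8-4\sqrt2)k+(3-2\sqrt2)\right]=\frac1\pi .$$ Moreover, put $$d_0=\sqrt2-1,\quad b_0=8-4\sqrt2,\quad a_0=3-2\sqrt2,\quad c_0=2\sqrt2,\quad r_0=t_0=\sqrt2-1,\quad s_0=\sqrt{d_0}.$$ Then $d_0=s_0^2$, $c_0=b_0/(1-d_0^2)$, $a_0=r_0-\frac{c_0}{2}d_0^2$, and each of the following four iterations, started at these values, tends to $1/\pi$. In the first three, $d_{n+1}=\dfrac{1-\sqrt{1-d_n^2}}{1+\sqrt{1-d_n^2}}$ for $n\ge0$. 1. $\lim_{n\to\infty} a_n=\frac1\pi$, where $b_{n+1}=2b_n\dfrac{(1+d_{n+1})^3}{1-d_{n+1}}$ and $a_{n+1}=a_n(1+d_{n+1})^2+\dfrac{b_{n+1}d_{n+1}}{2(1+d_{n+1})}$.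 2. $\lim_{n\to\infty} a'_n=\frac1\pi$, where $a'_0=a_0$ and $a'_{n+1}=a'_n(1+d_{n+1})^2+c_0\,2^n d_{n+1}(1-d_{n+1})$. 3. (Borweins' quadratic algorithm) $\lim_{n\to\infty} r_n=\frac1\pi$, where $r_{n+1}=r_n(1+d_{n+1})^2-c_0\,2^n d_{n+1}$. 4. (Borweins' quartic algorithm) $\lim_{n\to\infty} t_n=\frac1\pi$, where $s_{n+1}=\dfrac{1-\sqrt[4]{1-s_n^4}}{1+\sqrt[4]{1-s_n^4}}$ and $t_{n+1}=(1+s_{n+1})^4t_n-c_0\,2^{2n+1}s_{n+1}(1+s_{n+1}+s_{n+1}^2)$. -/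

import Mathlib

open Filter Topology

noncomputable section

/-- The rising factorial `(v)_k = v (v + 1) ⋯ (v + k - 1)`. -/
def poch (v : ℝ) (k : ℕ) : ℝ := (ascPochhammer ℝ k).eval v

/-- The coefficient `(1/2)_k ^ 2 / (1)_k ^ 2`. -/
def coeffD (k : ℕ) : ℝ := poch (1 / 2) k ^ 2 / poch 1 k ^ 2

/-- `d_{n+1} = (1 - √(1 - d_n²)) / (1 + √(1 - d_n²))`. -/
def dSeq (d₀ : ℝ) : ℕ → ℝ
  | 0 => d₀
  | n + 1 => (1 - √(1 - dSeq d₀ n ^ 2)) / (1 + √(1 - dSeq d₀ n ^ 2))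

/-- `b_{n+1} = 2 b_n (1 + d_{n+1})³ / (1 - d_{n+1})`. -/
def bSeq (d₀ b₀ : ℝ) : ℕ → ℝ
  | 0 => b₀
  | n + 1 => 2 * bSeq d₀ b₀ n * ((1 + dSeq d₀ (n + 1)) ^ 3 / (1 - dSeq d₀ (n + 1)))

/-- `a_{n+1} = a_n (1 + d_{n+1})² + b_{n+1} d_{n+1} / (2 (1 + d_{n+1}))`. -/
def aSeq (d₀ a₀ b₀ : ℝ) : ℕ → ℝ
  | 0 => a₀
  | n + 1 => aSeq d₀ a₀ b₀ n * (1 + dSeq d₀ (n + 1)) ^ 2 +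
      bSeq d₀ b₀ (n + 1) * dSeq d₀ (n + 1) / (2 * (1 + dSeq d₀ (n + 1)))

/-- Simplified version: `a_{n+1} = a_n (1 + d_{n+1})² + c₀ 2ⁿ d_{n+1} (1 - d_{n+1})`. -/
def aSimpleSeq (d₀ a₀ c₀ : ℝ) : ℕ → ℝ
  | 0 => a₀
  | n + 1 => aSimpleSeq d₀ a₀ c₀ n * (1 + dSeq d₀ (n + 1)) ^ 2 +
      c₀ * 2 ^ n * dSeq d₀ (n + 1) * (1 - dSeq d₀ (n + 1))

/-- Borweins' quadratic algorithm: `r_{n+1} = r_n (1 + d_{n+1})² - c₀ 2ⁿ d_{n+1}`. -/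
def rSeq (d₀ r₀ c₀ : ℝ) : ℕ → ℝ
  | 0 => r₀
  | n + 1 => rSeq d₀ r₀ c₀ n * (1 + dSeq d₀ (n + 1)) ^ 2 - c₀ * 2 ^ n * dSeq d₀ (n + 1)

/-- `s_{n+1} = (1 - ⁴√(1 - s_n⁴)) / (1 + ⁴√(1 - s_n⁴))`. -/
def sSeq (s₀ : ℝ) : ℕ → ℝ
  | 0 => s₀
  | n + 1 => (1 - (1 - sSeq s₀ n ^ 4) ^ (1 / 4 : ℝ)) / (1 + (1 - sSeq s₀ n ^ 4) ^ (1 / 4 : ℝ))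

/-- Borweins' quartic algorithm:
`t_{n+1} = (1 + s_{n+1})⁴ t_n - c₀ 2^{2n+1} s_{n+1} (1 + s_{n+1} + s_{n+1}²)`. -/
def tSeq (s₀ t₀ c₀ : ℝ) : ℕ → ℝ
  | 0 => t₀
  | n + 1 => (1 + sSeq s₀ (n + 1)) ^ 4 * tSeq s₀ t₀ c₀ n -
      c₀ * 2 ^ (2 * n + 1) * sSeq s₀ (n + 1) *
        (1 + sSeq s₀ (n + 1) + sSeq s₀ (n + 1) ^ 2)

end

/-! Write F = `ellF`, which is 2K/π. Landen's transformation F(4x/(1+x)²) = (1+x)F(x²) and its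
derivative show that F(dₙ²)(bₙdₙ²F'(dₙ²) + aₙF(dₙ²)) does not depend on n (`ellF_mul_invariant`):
the recurrences for a and b are exactly what the substitution produces. Since dₙ and 2ⁿdₙ tend to 0,
this constant is lim aₙ (`tendsto_aSeq`).

At n = 0 the constant is the product of the two series. For d = √2 - 1 one has 4d/(1+d)² = 1 - d²,
so Landen links d² to its complementary parameter, and Legendre's relation evaluates the constant as
1/π (`ellF_sqrt_two_sub_one`). The π comes from Wallis' product, through Abel's theorem at y = 1.

The other algorithms are disguises of the first: a'ₙ = aₙ, rₙ differs from aₙ by a vanishing term,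
and tₙ = r₂ₙ. -/

/-! ### Power series with bounded coefficients -/

/-- The real power series with coefficients `u`. -/
noncomputable def realSeries (u : ℕ → ℝ) (y : ℝ) : ℝ := ∑' k, u k * y ^ k

theorem summable_realSeries {u : ℕ → ℝ} {C : ℝ} (hu : ∀ k, |u k| ≤ C) {y : ℝ} (hy : |y| < 1) :
    Summable fun k => u k * y ^ k := by
  refine Summable.of_norm_bounded (g := fun k => C * |y| ^ k)
    ((summable_geometric_of_lt_one (abs_nonneg y) hy).mul_left C) fun k => ?_
  rw [Real.norm_eq_abs, abs_mul, abs_pow]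
  gcongr
  exact hu k

theorem hasDerivAt_realSeries {u : ℕ → ℝ} {C : ℝ} (hu : ∀ k, |u k| ≤ C) {y : ℝ} (hy : |y| < 1) :
    HasDerivAt (realSeries u) (realSeries (fun k => (k + 1) * u (k + 1)) y) y := by
  obtain ⟨r, hyr, hr1⟩ := exists_between hy
  have hr0 : 0 < r := (abs_nonneg y).trans_lt hyr
  have hgeom : Summable fun k : ℕ => C * ((k : ℝ) * r ^ (k - 1)) := by
    refine Summable.mul_left C ?_
    have h := summable_pow_mul_geometric_of_norm_lt_one 1 (r := r)
      (by rwa [Real.norm_eq_abs, abs_of_pos hr0])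
    refine (h.mul_left r⁻¹).congr fun k => ?_
    rcases k with _ | k
    · simp
    · simp only [Nat.add_sub_cancel, pow_succ]
      field_simp
  have hbound : ∀ (k : ℕ) (x : ℝ), x ∈ Metric.ball (0 : ℝ) r →
      ‖u k * (k * x ^ (k - 1))‖ ≤ C * ((k : ℝ) * r ^ (k - 1)) := by
    intro k x hx
    have hx' : |x| ≤ r := by simpa using (Metric.mem_ball.mp hx).le
    rw [Real.norm_eq_abs, abs_mul, abs_mul, abs_pow, Nat.abs_cast]
    have hC := (abs_nonneg _).trans (hu k)
    gcongr
    exact hu k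
  have hyball : y ∈ Metric.ball (0 : ℝ) r := by simpa using hyr
  have key := hasDerivAt_tsum_of_isPreconnected (g := fun k x => u k * x ^ k)
    (g' := fun k x => u k * (k * x ^ (k - 1))) hgeom Metric.isOpen_ball
    (convex_ball (0 : ℝ) r).isPreconnected
    (fun k x _ => (hasDerivAt_pow k x).const_mul (u k)) hbound hyball
    (summable_realSeries hu hy) hyball
  have hsum : Summable fun k : ℕ => u k * (k * y ^ (k - 1)) :=
    Summable.of_norm_bounded hgeom fun k => hbound k y hyball
  have hshift : ∑' k : ℕ, u k * (k * y ^ (k - 1)) =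
      realSeries (fun k => (k + 1) * u (k + 1)) y := by
    rw [hsum.tsum_eq_zero_add, realSeries]
    simp only [Nat.cast_zero, zero_mul, mul_zero, zero_add, Nat.add_sub_cancel, Nat.cast_add,
      Nat.cast_one]
    exact tsum_congr fun k => by ring
  rw [← hshift]
  exact key

theorem realSeries_zero (u : ℕ → ℝ) : realSeries u 0 = u 0 := by
  rw [realSeries, tsum_eq_single 0 fun k hk => by simp [hk]]
  simp

theorem mul_realSeries {u : ℕ → ℝ} {C : ℝ} (hu : ∀ k, |u k| ≤ C) {y : ℝ} (hy : |y| < 1) :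
    y * realSeries u y = realSeries (fun k => if k = 0 then 0 else u (k - 1)) y := by
  have hs : Summable fun k : ℕ => (if k = 0 then 0 else u (k - 1)) * y ^ k := by
    refine summable_realSeries (C := C) (fun k => ?_) hy
    split_ifs
    · simpa using (abs_nonneg _).trans (hu 0)
    · exact hu _
  rw [realSeries, realSeries, hs.tsum_eq_zero_add, ← tsum_mul_left]
  simp only [if_true, zero_mul, zero_add, Nat.add_eq_zero_iff, one_ne_zero, and_false, if_false,
    Nat.add_sub_cancel]
  exact tsum_congr fun k => by ring

theorem one_sub_mul_realSeries {u : ℕ → ℝ} {C : ℝ} (hu : ∀ k, |u k| ≤ C) {y : ℝ} (hy : |y| < 1) :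
    (1 - y) * realSeries u y =
      realSeries (fun k => u k - if k = 0 then 0 else u (k - 1)) y := by
  rw [sub_mul, one_mul, mul_realSeries hu hy, realSeries, realSeries, realSeries,
    ← (summable_realSeries hu hy).tsum_sub]
  · exact tsum_congr fun k => by ring
  · refine summable_realSeries (C := C) (fun k => ?_) hy
    split_ifs
    · simpa using (abs_nonneg _).trans (hu 0)
    · exact hu _

/-- Abel's theorem for bounded coefficients that converge. -/
theorem tendsto_one_sub_mul_realSeries {u : ℕ → ℝ} {C l : ℝ} (hu : ∀ k, |u k| ≤ C)
    (hl : Tendsto u atTop (𝓝 l)) :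
    Tendsto (fun y => (1 - y) * realSeries u y) (𝓝[<] 1) (𝓝 l) := by
  have hpartial : ∀ n, ∑ k ∈ Finset.range (n + 1), (u k - if k = 0 then 0 else u (k - 1)) = u n := by
    intro n
    induction n with
    | zero => simp
    | succ n ih => rw [Finset.sum_range_succ, ih]; simp
  -- Multiplying by 1 - y differences the coefficients, so their partial sums telescope back to u.
  have habel := Real.tendsto_tsum_powerSeries_nhdsWithin_lt
    (f := fun k => u k - if k = 0 then 0 else u (k - 1)) (l := l)
    ((tendsto_add_atTop_iff_nat 1).mp (hl.congr fun n => (hpartial n).symm))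
  refine habel.congr' ?_
  filter_upwards [Ioo_mem_nhdsLT (show (0 : ℝ) < 1 by norm_num)] with y hy
  rw [one_sub_mul_realSeries hu (by rw [abs_of_pos hy.1]; exact hy.2), realSeries]

/-! ### The coefficients and Wallis' product -/

theorem coeffD_zero : coeffD 0 = 1 := by simp [coeffD, poch]

theorem coeffD_succ (k : ℕ) : coeffD (k + 1) = coeffD k * ((2 * k + 1) / (2 * k + 2)) ^ 2 := by
  have h1 : poch 1 k ≠ 0 := by
    rw [poch]; exact (ascPochhammer_pos k (1 : ℝ) one_pos).ne'
  have h2 : (1 + k : ℝ) ≠ 0 := by positivity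
  have h3 : (2 * k + 2 : ℝ) ≠ 0 := by positivity
  have hp : ∀ v : ℝ, poch v (k + 1) = poch v k * (v + k) := fun v => by
    simp [poch, ascPochhammer_succ_eval]
  rw [coeffD, coeffD, hp, hp]
  field_simp
  ring

theorem coeffD_pos (k : ℕ) : 0 < coeffD k := by
  induction k with
  | zero => rw [coeffD_zero]; exact one_pos
  | succ k ih => rw [coeffD_succ]; positivity

/-- This link to Wallis' product is where π enters. -/
theorem two_mul_add_one_mul_coeffD (k : ℕ) : (2 * k + 1) * coeffD k = (Real.Wallis.W k)⁻¹ := by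
  induction k with
  | zero => simp [coeffD_zero, Real.Wallis.W]
  | succ k ih =>
    rw [Real.Wallis.W_succ, coeffD_succ, mul_inv, ← ih]
    push_cast
    field_simp
    ring

theorem coeffD_mul_le_one (k : ℕ) : (2 * k + 1) * coeffD k ≤ 1 := by
  induction k with
  | zero => simp [coeffD_zero]
  | succ k ih =>
    refine le_trans ?_ ih
    rw [coeffD_succ]
    have h : (2 * ((k + 1 : ℕ) : ℝ) + 1) * (coeffD k * ((2 * k + 1) / (2 * k + 2)) ^ 2) =
        (2 * k + 1) * coeffD k * ((2 * k + 1) * (2 * k + 3) / (2 * k + 2) ^ 2) := by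
      push_cast; field_simp; ring
    rw [h]
    refine mul_le_of_le_one_right (by have := coeffD_pos k; positivity) ?_
    rw [div_le_one (by positivity)]
    nlinarith

theorem abs_coeffD_le (k : ℕ) : |coeffD k| ≤ 1 := by
  rw [abs_of_pos (coeffD_pos k)]
  have h := coeffD_mul_le_one k
  have : 0 ≤ (k : ℝ) * coeffD k := mul_nonneg k.cast_nonneg (coeffD_pos k).le
  linarith

theorem abs_succ_mul_coeffD_le (k : ℕ) : |((k : ℝ) + 1) * coeffD (k + 1)| ≤ 1 := by
  have hp := coeffD_pos (k + 1)
  rw [abs_of_pos (by positivity)]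
  have h := coeffD_mul_le_one (k + 1)
  push_cast at h
  have : 0 ≤ ((k : ℝ) + 1) * coeffD (k + 1) := by positivity
  linarith

theorem tendsto_two_mul_add_one_mul_coeffD :
    Tendsto (fun k : ℕ => (2 * (k : ℝ) + 1) * coeffD k) atTop (𝓝 (2 / Real.pi)) := by
  have h := Real.Wallis.tendsto_W_nhds_pi_div_two.inv₀ (by positivity)
  rw [inv_div] at h
  exact h.congr fun k => (two_mul_add_one_mul_coeffD k).symm

theorem tendsto_coeffD : Tendsto coeffD atTop (𝓝 0) := by
  have hinv : Tendsto (fun k : ℕ => ((k : ℝ) + 1)⁻¹) atTop (𝓝 0) := by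
    simpa using tendsto_one_div_add_atTop_nhds_zero_nat (𝕜 := ℝ)
  refine squeeze_zero (fun k => (coeffD_pos k).le) (fun k => ?_) hinv
  rw [← one_div, le_div_iff₀ (by positivity)]
  have h := coeffD_mul_le_one k
  have : 0 ≤ (k : ℝ) * coeffD k := mul_nonneg k.cast_nonneg (coeffD_pos k).le
  linarith

theorem tendsto_succ_mul_coeffD :
    Tendsto (fun k : ℕ => ((k : ℝ) + 1) * coeffD (k + 1)) atTop (𝓝 (1 / Real.pi)) := by
  have h := (tendsto_two_mul_add_one_mul_coeffD.sub tendsto_coeffD).div_const 2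
  rw [sub_zero, div_right_comm, div_self two_ne_zero] at h
  refine ((tendsto_add_atTop_iff_nat 1).mpr h).congr fun k => ?_
  push_cast
  ring

/-! ### The hypergeometric equation and Legendre's relation -/

/-- `F(y) = ∑ (1/2)_k² / (1)_k² y^k`, which is `2/π` times the complete elliptic integral of the
first kind with parameter `y`. -/
noncomputable def ellF (y : ℝ) : ℝ := realSeries coeffD y

/-- The derivative of `ellF`. -/
noncomputable def ellF' (y : ℝ) : ℝ := realSeries (fun k => (k + 1) * coeffD (k + 1)) y

/-- `y (1 - y) F'(y)`, the flux of the hypergeometric equation of `ellF`. -/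
noncomputable def ellP (y : ℝ) : ℝ := y * (1 - y) * ellF' y

theorem hasDerivAt_ellF {y : ℝ} (hy : |y| < 1) : HasDerivAt ellF (ellF' y) y :=
  hasDerivAt_realSeries abs_coeffD_le hy

/-- The k-th coefficient of y(1-y)F' is k cₖ - (k-1) cₖ₋₁, and (2k-1)² - 4k(k-1) = 1 collapses it to
cₖ₋₁/(4k). -/
theorem ellP_eq_realSeries {y : ℝ} (hy : |y| < 1) :
    ellP y = realSeries (fun k => k * (if k = 0 then 0 else coeffD (k - 1) / (4 * k ^ 2))) y := by
  have hb : ∀ k : ℕ, |((k : ℝ) + 1) * coeffD (k + 1) -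
      if k = 0 then 0 else (((k - 1 : ℕ) : ℝ) + 1) * coeffD (k - 1 + 1)| ≤ 2 := by
    intro k
    refine (abs_sub _ _).trans ?_
    have h1 := abs_succ_mul_coeffD_le k
    have h2 : |if k = 0 then 0 else (((k - 1 : ℕ) : ℝ) + 1) * coeffD (k - 1 + 1)| ≤ 1 := by
      split_ifs
      · simp
      · exact abs_succ_mul_coeffD_le _
    linarith
  rw [ellP, mul_assoc, ellF', one_sub_mul_realSeries abs_succ_mul_coeffD_le hy,
    mul_realSeries hb hy]
  congr 1
  funext k
  rcases k with _ | k
  · simp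
  · simp only [Nat.add_eq_zero_iff, one_ne_zero, and_false, if_false, Nat.add_sub_cancel]
    rcases k with _ | k
    · simp [coeffD_succ, coeffD_zero]; norm_num
    · simp only [Nat.add_eq_zero_iff, one_ne_zero, and_false, if_false, Nat.add_sub_cancel]
      rw [coeffD_succ (k + 1)]
      push_cast
      field_simp
      ring

/-- The hypergeometric equation in self-adjoint form. Its symmetry under y ↦ 1 - y makes the
Wronskian in `legendre_relation` constant. -/
theorem hasDerivAt_ellP {y : ℝ} (hy : |y| < 1) : HasDerivAt ellP (ellF y / 4) y := by
  have hb : ∀ k : ℕ, |(k : ℝ) * (if k = 0 then 0 else coeffD (k - 1) / (4 * k ^ 2))| ≤ 1 := by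
    intro k
    rcases k with _ | k
    · simp
    · have h := abs_coeffD_le k
      have hp := coeffD_pos k
      rw [abs_of_pos hp] at h
      simp only [Nat.add_eq_zero_iff, one_ne_zero, and_false, if_false, Nat.add_sub_cancel]
      push_cast
      rw [abs_of_pos (by positivity), ← mul_div_assoc, div_le_one (by positivity)]
      have hk : (0 : ℝ) ≤ k := k.cast_nonneg
      nlinarith [mul_le_mul_of_nonneg_left h (show (0 : ℝ) ≤ k + 1 by positivity)]
  have h := hasDerivAt_realSeries hb hy
  have heq : realSeries (fun k : ℕ => ((k : ℝ) + 1) * (((k + 1 : ℕ) : ℝ) *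
      (if k + 1 = 0 then 0 else coeffD (k + 1 - 1) / (4 * ((k + 1 : ℕ) : ℝ) ^ 2)))) y =
      ellF y / 4 := by
    rw [ellF, realSeries, realSeries, ← tsum_div_const]
    refine tsum_congr fun k => ?_
    simp only [Nat.add_eq_zero_iff, one_ne_zero, and_false, if_false, Nat.add_sub_cancel]
    push_cast
    field_simp
  rw [heq] at h
  refine h.congr_of_eventuallyEq ?_
  filter_upwards [(isOpen_lt continuous_abs continuous_const).mem_nhds hy] with x hx
  exact ellP_eq_realSeries hx

theorem ellF_zero : ellF 0 = 1 := by rw [ellF, realSeries_zero, coeffD_zero]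

theorem ellF_pos {y : ℝ} (h0 : 0 ≤ y) (h1 : y < 1) : 0 < ellF y := by
  have hy : |y| < 1 := by rwa [abs_of_nonneg h0]
  have h := (summable_realSeries abs_coeffD_le hy).le_tsum 0 fun k _ =>
    mul_nonneg (coeffD_pos k).le (pow_nonneg h0 k)
  rw [pow_zero, mul_one, coeffD_zero] at h
  exact one_pos.trans_le h

theorem continuousAt_ellF' {y : ℝ} (hy : |y| < 1) : ContinuousAt ellF' y :=
  (hasDerivAt_realSeries abs_succ_mul_coeffD_le hy).continuousAt

/-- **Legendre's relation**, in Wronskian form. -/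
theorem legendre_relation {y : ℝ} (h0 : 0 < y) (h1 : y < 1) :
    ellP y * ellF (1 - y) + ellP (1 - y) * ellF y = 1 / Real.pi := by
  set L : ℝ → ℝ := fun y => ellP y * ellF (1 - y) + ellP (1 - y) * ellF y with hL
  have hder : ∀ x, 0 < x → x < 1 → HasDerivAt L 0 x := by
    intro x hx0 hx1
    have ha : |x| < 1 := by rwa [abs_of_pos hx0]
    have hb : |1 - x| < 1 := by rw [abs_of_pos (by linarith)]; linarith
    have hsub : HasDerivAt (fun x : ℝ => 1 - x) (-1) x := by
      simpa using (hasDerivAt_id x).const_sub 1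
    have hF := (hasDerivAt_ellF hb).comp x hsub
    have hP := (hasDerivAt_ellP hb).comp x hsub
    refine (((hasDerivAt_ellP ha).mul hF).add (hP.mul (hasDerivAt_ellF ha))).congr_deriv ?_
    simp only [Function.comp, ellP]
    ring
  have hconst : ∀ x, 0 < x → x < 1 → L x = L y := by
    intro x hx0 hx1
    refine (convex_Ioo (0 : ℝ) 1).is_const_of_fderivWithin_eq_zero (𝕜 := ℝ) (f := L) ?_ ?_
      ⟨hx0, hx1⟩ ⟨h0, h1⟩
    · exact fun z hz => (hder z hz.1 hz.2).differentiableAt.differentiableWithinAt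
    · intro z hz
      rw [fderivWithin_of_isOpen isOpen_Ioo hz]
      ext
      simpa using (hder z hz.1 hz.2).deriv
  -- The constant is found by letting x → 1⁻: (1-x)F'(x) → 1/π, while (1-x)F(x) → 0 kills the second
  -- term.
  have hy : Tendsto (fun x : ℝ => x) (𝓝[<] 1) (𝓝 1) := tendsto_id.mono_left nhdsWithin_le_nhds
  have hz : Tendsto (fun x : ℝ => 1 - x) (𝓝[<] 1) (𝓝 0) := by simpa using hy.const_sub 1
  have hF := (hasDerivAt_ellF (y := 0) (by simp)).continuousAt.tendsto.comp hz
  have hF' := (continuousAt_ellF' (y := 0) (by simp)).tendsto.comp hz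
  have hA := tendsto_one_sub_mul_realSeries abs_coeffD_le tendsto_coeffD
  have hB := tendsto_one_sub_mul_realSeries abs_succ_mul_coeffD_le tendsto_succ_mul_coeffD
  have hlim := ((hy.mul hB).mul hF).add ((hy.mul hF').mul hA)
  rw [ellF_zero, mul_zero, add_zero, one_mul, mul_one] at hlim
  refine tendsto_nhds_unique (tendsto_const_nhds.congr' ?_) hlim
  filter_upwards [Ioo_mem_nhdsLT (show (0 : ℝ) < 1 by norm_num)] with x hx
  have h := hconst x hx.1 hx.2
  simp only [hL] at h
  rw [← h, ellP, ellP]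
  simp only [Function.comp, ellF, ellF']
  ring

/-! ### Landen's transformation -/

theorem abs_landen_lt_one {x : ℝ} (h0 : 0 ≤ x) (h1 : x < 1) : |4 * x / (1 + x) ^ 2| < 1 := by
  rw [abs_of_nonneg (by positivity), div_lt_one (by positivity)]
  nlinarith [sq_nonneg (1 - x), mul_pos (sub_pos.mpr h1) (sub_pos.mpr h1)]

theorem hasDerivAt_landen {x : ℝ} (h0 : 0 ≤ x) :
    HasDerivAt (fun x : ℝ => 4 * x / (1 + x) ^ 2) (4 * (1 - x) / (1 + x) ^ 3) x := by
  have hx : 1 + x ≠ 0 := by positivity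
  have h := ((hasDerivAt_id x).const_mul 4).div
    (((hasDerivAt_id x).const_add 1).pow 2) (pow_ne_zero 2 hx)
  refine h.congr_deriv ?_
  simp only [id, Pi.pow_apply]
  field_simp
  ring

/-- **Landen's transformation**. -/
theorem ellF_landen {x : ℝ} (h0 : 0 ≤ x) (h1 : x < 1) :
    ellF (4 * x / (1 + x) ^ 2) = (1 + x) * ellF (x ^ 2) := by
  have hsq : ∀ z : ℝ, 0 ≤ z → z < 1 → |z ^ 2| < 1 := fun z hz0 hz1 => by
    rw [abs_of_nonneg (by positivity)]; nlinarith
  have hFl : ∀ z : ℝ, 0 ≤ z → z < 1 → HasDerivAt (fun z => ellF (4 * z / (1 + z) ^ 2))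
      (ellF' (4 * z / (1 + z) ^ 2) * (4 * (1 - z) / (1 + z) ^ 3)) z := fun z hz0 hz1 =>
    HasDerivAt.comp (h₂ := ellF) (h := fun z : ℝ => 4 * z / (1 + z) ^ 2) z
      (hasDerivAt_ellF (abs_landen_lt_one hz0 hz1)) (hasDerivAt_landen hz0)
  have hPl : ∀ z : ℝ, 0 ≤ z → z < 1 → HasDerivAt (fun z => ellP (4 * z / (1 + z) ^ 2))
      (ellF (4 * z / (1 + z) ^ 2) / 4 * (4 * (1 - z) / (1 + z) ^ 3)) z := fun z hz0 hz1 =>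
    HasDerivAt.comp (h₂ := ellP) (h := fun z : ℝ => 4 * z / (1 + z) ^ 2) z
      (hasDerivAt_ellP (abs_landen_lt_one hz0 hz1)) (hasDerivAt_landen hz0)
  have hsqd : ∀ z : ℝ, HasDerivAt (fun z : ℝ => z ^ 2) (2 * z) z := fun z => by
    simpa using hasDerivAt_pow 2 z
  have hFs : ∀ z : ℝ, 0 ≤ z → z < 1 →
      HasDerivAt (fun z => ellF (z ^ 2)) (ellF' (z ^ 2) * (2 * z)) z := fun z hz0 hz1 =>
    HasDerivAt.comp (h₂ := ellF) (h := fun z : ℝ => z ^ 2) z (hasDerivAt_ellF (hsq z hz0 hz1)) (hsqd z)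
  have hPs : ∀ z : ℝ, 0 ≤ z → z < 1 →
      HasDerivAt (fun z => ellP (z ^ 2)) (ellF (z ^ 2) / 4 * (2 * z)) z := fun z hz0 hz1 =>
    HasDerivAt.comp (h₂ := ellP) (h := fun z : ℝ => z ^ 2) z (hasDerivAt_ellP (hsq z hz0 hz1)) (hsqd z)
  have hone : ∀ z : ℝ, HasDerivAt (fun z : ℝ => 1 + z) 1 z := fun z => (hasDerivAt_id z).const_add 1
  -- The Wronskian of `ellF (x ^ 2)` and `ellF (4 x / (1 + x) ^ 2) / (1 + x)`.
  set V : ℝ → ℝ := fun z => ellF (z ^ 2) * ((1 + z) * ellP (4 * z / (1 + z) ^ 2) -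
      z * (1 - z) / (1 + z) * ellF (4 * z / (1 + z) ^ 2)) -
      2 * ellP (z ^ 2) * (ellF (4 * z / (1 + z) ^ 2) / (1 + z)) with hV
  -- `V` carries the weight z(1-z²); it is constant because both functions solve (z(1-z²)f')' = z f.
  have hVder : ∀ z : ℝ, 0 ≤ z → z < 1 → HasDerivAt V 0 z := by
    intro z hz0 hz1
    have hz : 1 + z ≠ 0 := by positivity
    have hid := hasDerivAt_id z
    have hq := ((hid.mul (hid.const_sub 1)).div (hone z) hz)
    have h := ((hFs z hz0 hz1).mul (((hone z).mul (hPl z hz0 hz1)).sub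
      (hq.mul (hFl z hz0 hz1)))).sub
      (((hPs z hz0 hz1).const_mul 2).mul ((hFl z hz0 hz1).div (hone z) hz))
    refine h.congr_deriv ?_
    simp only [id, ellP, Pi.mul_apply, Pi.sub_apply, Pi.div_apply]
    generalize ellF (4 * z / (1 + z) ^ 2) = A
    generalize ellF' (4 * z / (1 + z) ^ 2) = B
    generalize ellF (z ^ 2) = E
    generalize ellF' (z ^ 2) = G
    field_simp
    ring
  have hV0 : ∀ z : ℝ, 0 ≤ z → z < 1 → V z = 0 := by
    intro z hz0 hz1
    have h := constant_of_has_deriv_right_zero (f := V) (a := 0) (b := z)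
      (fun w hw => (hVder w hw.1 (hw.2.trans_lt hz1)).continuousAt.continuousWithinAt)
      (fun w hw => (hVder w hw.1 (hw.2.trans hz1)).hasDerivWithinAt) z ⟨hz0, le_rfl⟩
    rw [h]
    simp [hV, ellP]
  set R : ℝ → ℝ := fun z => ellF (4 * z / (1 + z) ^ 2) / ((1 + z) * ellF (z ^ 2)) with hR
  have hpos : ∀ z : ℝ, 0 ≤ z → z < 1 → 0 < ellF (z ^ 2) := fun z hz0 hz1 =>
    ellF_pos (by positivity) (by nlinarith)
  -- The weight vanishes at 0, so `V` = 0 yields R' = 0 only up to a factor z. The mean value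
  -- theorem below needs R' only at interior points.
  have hRder : ∀ z : ℝ, 0 ≤ z → z < 1 → ∃ e, HasDerivAt R e z ∧ z * e = 0 := by
    intro z hz0 hz1
    have hz : 1 + z ≠ 0 := by positivity
    have hf := (hpos z hz0 hz1).ne'
    have h1z : 1 - z ≠ 0 := by linarith
    refine ⟨_, (hFl z hz0 hz1).div ((hone z).mul (hFs z hz0 hz1)) (mul_ne_zero hz hf), ?_⟩
    have h := hV0 z hz0 hz1
    simp only [hV, ellP] at h
    generalize ellF (4 * z / (1 + z) ^ 2) = A at *
    generalize ellF' (4 * z / (1 + z) ^ 2) = B at *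
    generalize ellF (z ^ 2) = E at *
    generalize ellF' (z ^ 2) = G at *
    have hm : (1 - z) * (z * (4 * (1 - z) * B * E / (1 + z) ^ 2 - A * (E + (1 + z) * (2 * z * G)))) = 0 := by
      refine Eq.trans ?_ (congrArg (fun w => w * (1 + z)) h |>.trans (zero_mul _))
      field_simp
      ring
    have hm' := (mul_eq_zero.mp hm).resolve_left h1z
    rw [← mul_div_assoc, div_eq_zero_iff]
    left
    refine Eq.trans ?_ hm'
    field_simp
  have hR1 : R x = R 0 := by
    rcases h0.eq_or_lt with rfl | hx
    · rfl
    obtain ⟨c, hc, hslope⟩ := exists_deriv_eq_slope R hx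
      (fun w hw => by
        obtain ⟨e, he, -⟩ := hRder w hw.1 (hw.2.trans_lt h1)
        exact he.continuousAt.continuousWithinAt)
      (fun w hw => by
        obtain ⟨e, he, -⟩ := hRder w hw.1.le (hw.2.trans h1)
        exact he.differentiableAt.differentiableWithinAt)
    obtain ⟨e, he, he0⟩ := hRder c hc.1.le (hc.2.trans h1)
    rw [he.deriv, (mul_eq_zero.mp he0).resolve_left hc.1.ne', eq_comm, div_eq_zero_iff] at hslope
    rcases hslope with h | h <;> linarith
  have hR0 : R 0 = 1 := by simp [hR, ellF_zero]
  rw [hR0] at hR1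
  have hne : (1 + x) * ellF (x ^ 2) ≠ 0 := mul_ne_zero (by positivity) (hpos x h0 h1).ne'
  simpa only [hR, div_eq_one_iff_eq hne] using hR1

/-- The derivative of Landen's transformation. -/
theorem ellF'_landen {x : ℝ} (h0 : 0 < x) (h1 : x < 1) :
    ellF' (4 * x / (1 + x) ^ 2) * (4 * (1 - x) / (1 + x) ^ 3) =
      ellF (x ^ 2) + (1 + x) * (2 * x * ellF' (x ^ 2)) := by
  have hx2 : |x ^ 2| < 1 := by rw [abs_of_nonneg (by positivity)]; nlinarith
  have hl := (hasDerivAt_ellF (abs_landen_lt_one h0.le h1)).comp x (hasDerivAt_landen h0.le)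
  have hs := HasDerivAt.comp (h₂ := ellF) (h := fun z : ℝ => z ^ 2) x (hasDerivAt_ellF hx2) (hasDerivAt_pow 2 x)
  have hr := ((hasDerivAt_id x).const_add 1).mul hs
  have heq : (ellF ∘ fun x : ℝ => 4 * x / (1 + x) ^ 2) =ᶠ[𝓝 x]
      (fun x => (1 + id x) * (ellF ∘ fun x => x ^ 2) x) := by
    filter_upwards [Ioo_mem_nhds h0 h1] with z hz
    exact ellF_landen hz.1.le hz.2
  rw [hl.unique (hr.congr_of_eventuallyEq heq)]
  simp only [id, Function.comp]
  push_cast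
  ring

/-- The descending Landen step on `(0, 1)` inverts `x ↦ 4 x / (1 + x) ^ 2` on squares. -/
theorem landen_step {d : ℝ} (h0 : 0 < d) (h1 : d < 1) :
    0 < (1 - √(1 - d ^ 2)) / (1 + √(1 - d ^ 2)) ∧ (1 - √(1 - d ^ 2)) / (1 + √(1 - d ^ 2)) < 1 ∧
      d ^ 2 = 4 * ((1 - √(1 - d ^ 2)) / (1 + √(1 - d ^ 2))) /
        (1 + (1 - √(1 - d ^ 2)) / (1 + √(1 - d ^ 2))) ^ 2 := by
  have hd : 0 < 1 - d ^ 2 := by nlinarith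
  have hz0 : 0 < √(1 - d ^ 2) := Real.sqrt_pos.mpr hd
  have hz2 : √(1 - d ^ 2) ^ 2 = 1 - d ^ 2 := Real.sq_sqrt hd.le
  generalize √(1 - d ^ 2) = z at *
  have hz1 : z < 1 := by nlinarith
  refine ⟨div_pos (by linarith) (by linarith), (div_lt_one (by linarith)).mpr (by linarith), ?_⟩
  have h : 1 + (1 - z) / (1 + z) = 2 / (1 + z) := by field_simp; ring
  rw [h]
  field_simp
  linarith

/-! ### The iterations -/

section LandenSequence

variable {d₀ : ℝ}

theorem dSeq_mem (h0 : 0 < d₀) (h1 : d₀ < 1) (n : ℕ) : 0 < dSeq d₀ n ∧ dSeq d₀ n < 1 := by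
  induction n with
  | zero => exact ⟨h0, h1⟩
  | succ n ih => exact ⟨(landen_step ih.1 ih.2).1, (landen_step ih.1 ih.2).2.1⟩

theorem dSeq_sq (h0 : 0 < d₀) (h1 : d₀ < 1) (n : ℕ) :
    dSeq d₀ n ^ 2 = 4 * dSeq d₀ (n + 1) / (1 + dSeq d₀ (n + 1)) ^ 2 :=
  (landen_step (dSeq_mem h0 h1 n).1 (dSeq_mem h0 h1 n).2).2.2

theorem dSeq_succ_le (h0 : 0 < d₀) (h1 : d₀ < 1) (n : ℕ) : dSeq d₀ (n + 1) ≤ dSeq d₀ n ^ 2 := by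
  obtain ⟨hx0, hx1⟩ := dSeq_mem h0 h1 (n + 1)
  rw [dSeq_sq h0 h1, le_div_iff₀ (by positivity)]
  nlinarith [mul_pos hx0 hx0]

/-- Far weaker than the true quadratic convergence, but enough to beat 2ⁿ when d₀ < 1/2. -/
theorem dSeq_le_pow (h0 : 0 < d₀) (h1 : d₀ < 1) (n : ℕ) : dSeq d₀ n ≤ d₀ ^ (n + 1) := by
  induction n with
  | zero => simp [dSeq]
  | succ n ih =>
    have hn := (dSeq_mem h0 h1 n).1
    calc dSeq d₀ (n + 1) ≤ dSeq d₀ n ^ 2 := dSeq_succ_le h0 h1 n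
      _ = dSeq d₀ n * dSeq d₀ n := sq _
      _ ≤ d₀ ^ (n + 1) * d₀ := by
        refine mul_le_mul ih (ih.trans ?_) hn.le (by positivity)
        exact pow_le_of_le_one h0.le h1.le (Nat.succ_ne_zero n)
      _ = d₀ ^ (n + 1 + 1) := (pow_succ _ _).symm

/-- Since 1 - dₙ² = ((1-dₙ₊₁)/(1+dₙ₊₁))², the ratio bₙ/(1-dₙ²) doubles at each step. -/
theorem bSeq_eq {c₀ b₀ : ℝ} (h0 : 0 < d₀) (h1 : d₀ < 1) (hc : c₀ = b₀ / (1 - d₀ ^ 2)) (n : ℕ) :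
    bSeq d₀ b₀ n = c₀ * 2 ^ n * (1 - dSeq d₀ n ^ 2) := by
  induction n with
  | zero =>
    have : 1 - d₀ ^ 2 ≠ 0 := by nlinarith
    simp only [bSeq, dSeq, hc]
    field_simp
  | succ n ih =>
    obtain ⟨hx0, hx1⟩ := dSeq_mem h0 h1 (n + 1)
    have h : 1 - dSeq d₀ (n + 1) ≠ 0 := by linarith
    rw [bSeq, ih, dSeq_sq h0 h1]
    field_simp
    ring

theorem aSimpleSeq_eq {a₀ b₀ c₀ : ℝ} (h0 : 0 < d₀) (h1 : d₀ < 1) (hc : c₀ = b₀ / (1 - d₀ ^ 2))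
    (n : ℕ) : aSimpleSeq d₀ a₀ c₀ n = aSeq d₀ a₀ b₀ n := by
  induction n with
  | zero => rfl
  | succ n ih =>
    obtain ⟨hx0, hx1⟩ := dSeq_mem h0 h1 (n + 1)
    rw [aSimpleSeq, aSeq, ih, bSeq_eq h0 h1 hc]
    field_simp
    ring

/-- The correction propagates because (1+dₙ₊₁)²dₙ² = 4dₙ₊₁. -/
theorem rSeq_eq {a₀ c₀ r₀ : ℝ} (h0 : 0 < d₀) (h1 : d₀ < 1) (ha : a₀ = r₀ - c₀ / 2 * d₀ ^ 2)
    (n : ℕ) : rSeq d₀ r₀ c₀ n = aSimpleSeq d₀ a₀ c₀ n + c₀ * 2 ^ n / 2 * dSeq d₀ n ^ 2 := by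
  induction n with
  | zero => simp only [rSeq, aSimpleSeq, dSeq, ha]; ring
  | succ n ih =>
    obtain ⟨hx0, hx1⟩ := dSeq_mem h0 h1 (n + 1)
    rw [rSeq, aSimpleSeq, ih, dSeq_sq h0 h1]
    field_simp
    ring

/-- The quartic step is the square root of two Landen steps. -/
theorem dSeq_two_mul {s₀ : ℝ} (hs0 : 0 < s₀) (hs1 : s₀ < 1) (hs : d₀ = s₀ ^ 2) (n : ℕ) :
    0 < sSeq s₀ n ∧ sSeq s₀ n < 1 ∧ dSeq d₀ (2 * n) = sSeq s₀ n ^ 2 ∧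
      dSeq d₀ (2 * n + 1) = 2 * sSeq s₀ (n + 1) / (1 + sSeq s₀ (n + 1) ^ 2) ∧
      dSeq d₀ (2 * n + 2) = sSeq s₀ (n + 1) ^ 2 := by
  have step : ∀ n, 0 < sSeq s₀ n → sSeq s₀ n < 1 → dSeq d₀ (2 * n) = sSeq s₀ n ^ 2 →
      0 < sSeq s₀ (n + 1) ∧ sSeq s₀ (n + 1) < 1 ∧
      dSeq d₀ (2 * n + 1) = 2 * sSeq s₀ (n + 1) / (1 + sSeq s₀ (n + 1) ^ 2) ∧
      dSeq d₀ (2 * n + 2) = sSeq s₀ (n + 1) ^ 2 := by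
    intro n h0 h1 hd
    have h4 : sSeq s₀ n ^ 4 < 1 := pow_lt_one₀ h0.le h1 (by norm_num)
    have h4' : 0 < sSeq s₀ n ^ 4 := by positivity
    have hz0 : 0 < (1 - sSeq s₀ n ^ 4) ^ (1 / 4 : ℝ) := Real.rpow_pos_of_pos (by linarith) _
    have hz1 : (1 - sSeq s₀ n ^ 4) ^ (1 / 4 : ℝ) < 1 :=
      Real.rpow_lt_one (by linarith) (by linarith) (by norm_num)
    have hz4 : ((1 - sSeq s₀ n ^ 4) ^ (1 / 4 : ℝ)) ^ 4 = 1 - sSeq s₀ n ^ 4 := by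
      rw [← Real.rpow_natCast, ← Real.rpow_mul (by linarith)]
      norm_num
    rw [dSeq.eq_2 d₀ (2 * n + 1), dSeq.eq_2 d₀ (2 * n), hd, sSeq.eq_2]
    generalize (1 - sSeq s₀ n ^ 4) ^ (1 / 4 : ℝ) = z at *
    -- With z the fourth root, the intermediate d is (1-z²)/(1+z²), whose complementary modulus is
    -- the rational 2z/(1+z²).
    have hsq : √(1 - (sSeq s₀ n ^ 2) ^ 2) = z ^ 2 := by
      rw [← pow_mul, ← hz4, show z ^ 4 = (z ^ 2) ^ 2 by ring, Real.sqrt_sq (by positivity)]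
    have hsq2 : √(1 - ((1 - z ^ 2) / (1 + z ^ 2)) ^ 2) = 2 * z / (1 + z ^ 2) := by
      rw [show 1 - ((1 - z ^ 2) / (1 + z ^ 2)) ^ 2 = (2 * z / (1 + z ^ 2)) ^ 2 by
        field_simp; ring, Real.sqrt_sq (by positivity)]
    rw [hsq, hsq2]
    refine ⟨div_pos (by linarith) (by linarith), (div_lt_one (by linarith)).mpr (by linarith),
      ?_, ?_⟩
    · have h : 1 + ((1 - z) / (1 + z)) ^ 2 = 2 * (1 + z ^ 2) / (1 + z) ^ 2 := by
        field_simp; ring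
      rw [h]
      field_simp
      ring
    · have h : 1 + 2 * z / (1 + z ^ 2) = (1 + z) ^ 2 / (1 + z ^ 2) := by
        field_simp; ring
      rw [h]
      field_simp
      ring
  induction n with
  | zero =>
    have hd : dSeq d₀ (2 * 0) = sSeq s₀ 0 ^ 2 := hs
    obtain ⟨-, -, h⟩ := step 0 hs0 hs1 hd
    exact ⟨hs0, hs1, hd, h⟩
  | succ n ih =>
    obtain ⟨h0, h1, hd, -, h2⟩ := ih
    obtain ⟨h0', h1', -⟩ := step n h0 h1 hd
    obtain ⟨-, -, h⟩ := step (n + 1) h0' h1' h2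
    exact ⟨h0', h1', h2, h⟩

theorem tSeq_eq {s₀ t₀ c₀ : ℝ} (hs0 : 0 < s₀) (hs1 : s₀ < 1) (hs : d₀ = s₀ ^ 2) (n : ℕ) :
    tSeq s₀ t₀ c₀ n = rSeq d₀ t₀ c₀ (2 * n) := by
  induction n with
  | zero => rfl
  | succ n ih =>
    obtain ⟨-, -, -, h1, h2⟩ := dSeq_two_mul hs0 hs1 hs n
    rw [tSeq, ih, Nat.mul_succ, rSeq, rSeq, h1, h2]
    field_simp
    ring

/-- The quantity preserved by the quadratic iteration. -/
theorem ellF_mul_invariant {a₀ b₀ : ℝ} (h0 : 0 < d₀) (h1 : d₀ < 1) (n : ℕ) :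
    ellF (dSeq d₀ n ^ 2) * (bSeq d₀ b₀ n * (dSeq d₀ n ^ 2 * ellF' (dSeq d₀ n ^ 2)) +
      aSeq d₀ a₀ b₀ n * ellF (dSeq d₀ n ^ 2)) =
    ellF (d₀ ^ 2) * (b₀ * (d₀ ^ 2 * ellF' (d₀ ^ 2)) + a₀ * ellF (d₀ ^ 2)) := by
  induction n with
  | zero => rfl
  | succ n ih =>
    rw [← ih]
    obtain ⟨hx0, hx1⟩ := dSeq_mem h0 h1 (n + 1)
    rw [dSeq_sq h0 h1 n, aSeq, bSeq]
    have hF := ellF_landen hx0.le hx1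
    have hF' := ellF'_landen hx0 hx1
    generalize dSeq d₀ (n + 1) = x at *
    have hx : 1 - x ≠ 0 := by linarith
    have hF'' : ellF' (4 * x / (1 + x) ^ 2) =
        (ellF (x ^ 2) + (1 + x) * (2 * x * ellF' (x ^ 2))) * (1 + x) ^ 3 / (4 * (1 - x)) := by
      rw [← hF']
      field_simp
    rw [hF, hF'']
    field_simp
    ring

theorem tendsto_two_pow_mul_dSeq (h0 : 0 < d₀) (h1 : d₀ < 1 / 2) :
    Tendsto (fun n => 2 ^ n * dSeq d₀ n) atTop (𝓝 0) := by
  have hd1 : d₀ < 1 := by linarith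
  refine squeeze_zero (g := fun n => (2 * d₀) ^ n)
    (fun n => mul_nonneg (by positivity) (dSeq_mem h0 hd1 n).1.le) (fun n => ?_)
    (tendsto_pow_atTop_nhds_zero_of_lt_one (by positivity) (by linarith))
  rw [mul_pow]
  gcongr
  refine (dSeq_le_pow h0 hd1 n).trans ?_
  rw [pow_succ]
  exact mul_le_of_le_one_right (by positivity) hd1.le

theorem tendsto_dSeq (h0 : 0 < d₀) (h1 : d₀ < 1) : Tendsto (dSeq d₀) atTop (𝓝 0) := by
  refine squeeze_zero (fun n => (dSeq_mem h0 h1 n).1.le) (dSeq_le_pow h0 h1) ?_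
  exact (tendsto_add_atTop_iff_nat 1).mpr (tendsto_pow_atTop_nhds_zero_of_lt_one h0.le h1)

theorem tendsto_aSeq {a₀ b₀ : ℝ} (h0 : 0 < d₀) (h1 : d₀ < 1 / 2) :
    Tendsto (aSeq d₀ a₀ b₀) atTop
      (𝓝 (ellF (d₀ ^ 2) * (b₀ * (d₀ ^ 2 * ellF' (d₀ ^ 2)) + a₀ * ellF (d₀ ^ 2)))) := by
  have hd1 : d₀ < 1 := by linarith
  have hd := tendsto_dSeq h0 hd1
  have hsq : Tendsto (fun n => dSeq d₀ n ^ 2) atTop (𝓝 0) := by simpa using hd.pow 2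
  have hF : Tendsto (fun n => ellF (dSeq d₀ n ^ 2)) atTop (𝓝 1) := by
    have h := (hasDerivAt_ellF (y := 0) (by simp)).continuousAt.tendsto.comp hsq
    rwa [ellF_zero] at h
  have hF' := (continuousAt_ellF' (y := 0) (by simp)).tendsto.comp hsq
  have hb : Tendsto (fun n => bSeq d₀ b₀ n * (dSeq d₀ n ^ 2 * ellF' (dSeq d₀ n ^ 2))) atTop
      (𝓝 0) := by
    have h := ((((tendsto_two_pow_mul_dSeq h0 h1).const_mul (b₀ / (1 - d₀ ^ 2))).mul
      (hsq.const_sub 1)).mul hd).mul hF'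
    simp only [mul_zero, zero_mul] at h
    refine h.congr fun n => ?_
    rw [bSeq_eq h0 hd1 rfl]
    simp only [Function.comp]
    ring
  -- The invariant solved for aₙ.
  have hlim := ((tendsto_const_nhds (x := ellF (d₀ ^ 2) * (b₀ * (d₀ ^ 2 * ellF' (d₀ ^ 2)) +
    a₀ * ellF (d₀ ^ 2))) (f := atTop)).sub (hF.mul hb)).div (hF.pow 2) (by norm_num)
  rw [mul_zero, sub_zero, one_pow, div_one] at hlim
  refine hlim.congr fun n => ?_
  have hpos : 0 < ellF (dSeq d₀ n ^ 2) := by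
    obtain ⟨hx0, hx1⟩ := dSeq_mem h0 hd1 n
    exact ellF_pos (by positivity) (by nlinarith)
  rw [← ellF_mul_invariant (a₀ := a₀) (b₀ := b₀) h0 hd1 n]
  simp only [Pi.div_apply]
  field_simp
  ring

end LandenSequence

/-! ### The singular value and the conclusion -/

/-- The singular value at `√2 - 1`, where the complementary modulus is one Landen step away. -/
theorem ellF_sqrt_two_sub_one {d : ℝ} (h0 : 0 < d) (h1 : d < 1) (hd : d ^ 2 + 2 * d = 1) :
    ellF (d ^ 2) * (4 * (1 + d) * d * (d ^ 2 * ellF' (d ^ 2)) + d ^ 2 * ellF (d ^ 2)) =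
      1 / Real.pi := by
  -- This makes the Landen image of d equal to 1 - d², so F and F' at 1 - d² reduce to their values
  -- at d².
  have hx : (1 + d) ^ 2 = 2 := by linarith
  have hφ : 4 * d / (1 + d) ^ 2 = 1 - d ^ 2 := by rw [hx]; linarith
  have hφ' : 4 * (1 - d) / (1 + d) ^ 3 = 2 * d := by
    rw [div_eq_iff (by positivity), pow_succ, hx]; linarith
  have hF := ellF_landen h0.le h1
  have hF' := ellF'_landen h0 h1
  rw [hφ] at hF hF'
  rw [hφ'] at hF'
  have hL := legendre_relation (y := d ^ 2) (by positivity) (by nlinarith)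
  rw [← hL, ellP, ellP, hF, sub_sub_cancel]
  have h1d : 1 - d ^ 2 = 2 * d := by linarith
  rw [h1d] at hF' ⊢
  linear_combination (-(d ^ 2 * ellF (d ^ 2))) * hF'

theorem summable_coeffD_mul_linear {y : ℝ} (hy : |y| < 1) :
    Summable (fun k : ℕ => coeffD k * y ^ k * k) ∧
      ∑' k : ℕ, coeffD k * y ^ k * k = y * ellF' y := by
  have hs : Summable (fun k : ℕ => coeffD k * y ^ k * k) := by
    rw [← summable_nat_add_iff 1]
    refine ((summable_realSeries abs_succ_mul_coeffD_le hy).mul_left y).congr fun k => ?_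
    push_cast
    ring
  refine ⟨hs, ?_⟩
  rw [hs.tsum_eq_zero_add, ellF', realSeries, ← tsum_mul_left, Nat.cast_zero, mul_zero, zero_add]
  refine tsum_congr fun k => ?_
  push_cast
  ring

theorem mainTheorem6
    (d₀ a₀ b₀ c₀ r₀ s₀ t₀ : ℝ)
    (hd : d₀ = √2 - 1) (hb : b₀ = 8 - 4 * √2) (ha : a₀ = 3 - 2 * √2)
    (hc : c₀ = 2 * √2) (hr : r₀ = √2 - 1) (hs : s₀ = √d₀) (ht : t₀ = r₀) :
    -- the identity, with convergence of both series
    (Summable (fun k : ℕ => coeffD k * (√2 - 1) ^ (2 * k)) ∧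
      Summable (fun k : ℕ =>
        coeffD k * (√2 - 1) ^ (2 * k) * ((8 - 4 * √2) * k + (3 - 2 * √2))) ∧
      (∑' k : ℕ, coeffD k * (√2 - 1) ^ (2 * k)) *
        (∑' k : ℕ, coeffD k * (√2 - 1) ^ (2 * k) *
          ((8 - 4 * √2) * k + (3 - 2 * √2))) = 1 / Real.pi) ∧
    -- the relations by which the initial values of the algorithms are linked
    (d₀ = s₀ ^ 2 ∧ c₀ = b₀ / (1 - d₀ ^ 2) ∧ a₀ = r₀ - c₀ / 2 * d₀ ^ 2) ∧
    -- with these initial values every one of the algorithms tends to `1 / π`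
    Tendsto (aSeq d₀ a₀ b₀) atTop (𝓝 (1 / Real.pi)) ∧
    Tendsto (aSimpleSeq d₀ a₀ c₀) atTop (𝓝 (1 / Real.pi)) ∧
    Tendsto (rSeq d₀ r₀ c₀) atTop (𝓝 (1 / Real.pi)) ∧
    Tendsto (tSeq s₀ t₀ c₀) atTop (𝓝 (1 / Real.pi)) := by
  have h2 : √2 ^ 2 = 2 := Real.sq_sqrt (by norm_num)
  have h2l : 1.4 < √2 := Real.lt_sqrt_of_sq_lt (by norm_num)
  -- The bound 3/2 gives d₀ < 1/2, as `tendsto_aSeq` requires.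
  have h2u : √2 < 1.5 := (Real.sqrt_lt' (by norm_num)).mpr (by norm_num)
  have h0 : 0 < d₀ := by rw [hd]; linarith
  have hh : d₀ < 1 / 2 := by rw [hd]; linarith
  have h1 : d₀ < 1 := by linarith
  have hq : d₀ ^ 2 + 2 * d₀ = 1 := by rw [hd]; linear_combination h2
  have hy : |d₀ ^ 2| < 1 := by rw [abs_of_nonneg (by positivity)]; nlinarith
  have hs2 : d₀ = s₀ ^ 2 := by rw [hs, Real.sq_sqrt h0.le]
  have hs0 : 0 < s₀ := by rw [hs]; exact Real.sqrt_pos.mpr h0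
  have hs1 : s₀ < 1 := by nlinarith
  have hcb : c₀ = b₀ / (1 - d₀ ^ 2) := by
    rw [eq_div_iff (by nlinarith), hc, hb, hd]
    linear_combination (4 - 2 * √2) * h2
  have har : a₀ = r₀ - c₀ / 2 * d₀ ^ 2 := by
    rw [ha, hr, hc, hd]
    linear_combination (√2 - 2) * h2
  have hval : ellF (d₀ ^ 2) * (b₀ * (d₀ ^ 2 * ellF' (d₀ ^ 2)) + a₀ * ellF (d₀ ^ 2)) =
      1 / Real.pi := by
    rw [← ellF_sqrt_two_sub_one h0 h1 hq]
    have hb' : b₀ = 4 * (1 + d₀) * d₀ := by rw [hb, hd]; linear_combination (-4) * h2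
    have ha' : a₀ = d₀ ^ 2 := by rw [ha, hd]; linear_combination (-1) * h2
    rw [hb', ha']
  have hA : Tendsto (aSeq d₀ a₀ b₀) atTop (𝓝 (1 / Real.pi)) := hval ▸ tendsto_aSeq h0 hh
  have hA' : Tendsto (aSimpleSeq d₀ a₀ c₀) atTop (𝓝 (1 / Real.pi)) :=
    hA.congr fun n => (aSimpleSeq_eq h0 h1 hcb n).symm
  have hR : Tendsto (rSeq d₀ r₀ c₀) atTop (𝓝 (1 / Real.pi)) := by
    have h := hA'.add (((tendsto_two_pow_mul_dSeq h0 hh).mul (tendsto_dSeq h0 h1)).const_mul (c₀ / 2))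
    rw [mul_zero, mul_zero, add_zero] at h
    refine h.congr fun n => ?_
    rw [rSeq_eq h0 h1 har]
    ring
  have hT : Tendsto (tSeq s₀ t₀ c₀) atTop (𝓝 (1 / Real.pi)) := by
    have h := hR.comp (tendsto_id.const_mul_atTop' (show 0 < 2 by norm_num))
    refine h.congr fun n => ?_
    rw [tSeq_eq hs0 hs1 hs2, ht]
    rfl
  have hS := summable_realSeries abs_coeffD_le hy
  obtain ⟨hS', hsum⟩ := summable_coeffD_mul_linear hy
  have hlin : (fun k : ℕ => coeffD k * d₀ ^ (2 * k) * (b₀ * k + a₀)) =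
      fun k : ℕ => b₀ * (coeffD k * (d₀ ^ 2) ^ k * k) + a₀ * (coeffD k * (d₀ ^ 2) ^ k) := by
    funext k
    rw [pow_mul]
    ring
  rw [← hd, ← hb, ← ha]
  refine ⟨⟨?_, ?_, ?_⟩, ⟨hs2, hcb, har⟩, hA, hA', hR, hT⟩
  · simpa only [pow_mul] using hS
  · rw [hlin]
    exact (hS'.mul_left b₀).add (hS.mul_left a₀)
  · rw [← hval, hlin, (hS'.mul_left b₀).tsum_add (hS.mul_left a₀), tsum_mul_left, tsum_mul_left,
      hsum]
    simp only [pow_mul]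
    rfl
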